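/- Let $(Y,\|\cdot\|)$ be a real normed space of dimension at least $2$. A set $C\subseteq Y$ is a (not necessarily convex) cone if $0\in C=\mathbb R_+\cdot C$, and it is nontrivial if $\{0\}\ne C\ne Y$. For a norm $\psi$ on $Y$ and a cone $C$ put $$B_C(\psi)=\{x\in C:\psi(x)=1\},\qquad S_C(\psi)=\operatorname{conv}B_C(\psi),\qquad S^0_C(\psi)=\operatorname{conv}(\{0\}\cup B_C(\psi)).$$ Let $\operatorname{cl}$ and $\operatorname{cl}_w$ denote the closure in the norm topology and in the weak topology of $Y$. Let $K,A\subseteq Y$ be nontrivial cones such that $$A\cap\operatorname{cl}(\operatorname{conv}(-K))=\{0\}\qquad\text{and}\qquad 0\notin\operatorname{cl}S_{-K}(\|\cdot\|),$$ and assume that at least one of the following holds: (a) $B_A(\|\cdot\|)$ is compact; (b) $A$ is weakly closed, and either $Y$ is reflexive, or $\operatorname{cl}_w B_A(\|\cdot\|)$ is weakly compact with $0\notin\operatorname{cl}_w B_A(\|\cdot\|)$. Then there is a norm $\|\cdot\|'$ on $Y$ equivalent to $\|\cdot\|$ such that $$\operatorname{cl}S^0_A(\|\cdot\|')\cap\operatorname{cl}S_{-K}(\|\cdot\|')=\emptyset.$$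 -/

import Mathlib

open scoped Pointwise

namespace ConeSep

/-- A (not necessarily convex) cone: `0 ∈ K = ℝ₊ • K`. -/
def IsCone {Y : Type*} [AddCommGroup Y] [Module ℝ Y] (K : Set Y) : Prop :=
  (0 : Y) ∈ K ∧ K = Set.Ici (0 : ℝ) • K

/-- A nontrivial (proper) cone: `{0} ≠ K ≠ Y`. -/
def IsNontrivialCone {Y : Type*} [AddCommGroup Y] [Module ℝ Y] (K : Set Y) : Prop :=
  IsCone K ∧ K ≠ {0} ∧ K ≠ Set.univ

/-- `B_C(ψ) = {x ∈ C | ψ x = 1}`. When `ψ` is a norm this is the norm-base of `C`; the requirement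
that `ψ` be positive on `C \ {0}` is then automatic. -/
def normBase {Y : Type*} [AddCommGroup Y] [Module ℝ Y] (ψ : Seminorm ℝ Y) (C : Set Y) : Set Y :=
  {x | x ∈ C ∧ ψ x = 1}

/-- `S_C(ψ) = conv B_C(ψ)`. -/
def S {Y : Type*} [AddCommGroup Y] [Module ℝ Y] (ψ : Seminorm ℝ Y) (C : Set Y) : Set Y :=
  convexHull ℝ (normBase ψ C)

/-- `S_C^0(ψ) = conv ({0} ∪ B_C(ψ))`. -/
def S0 {Y : Type*} [AddCommGroup Y] [Module ℝ Y] (ψ : Seminorm ℝ Y) (C : Set Y) : Set Y :=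
  convexHull ℝ ({0} ∪ normBase ψ C)

/-- `p` is a norm on `Y` equivalent to the given norm (the lower bound makes `p` definite, and the
two bounds make the topology of `p` the topology of `Y`). -/
def IsEquivalentNorm {Y : Type*} [NormedAddCommGroup Y] [NormedSpace ℝ Y]
    (p : Seminorm ℝ Y) : Prop :=
  ∃ c C : ℝ, 0 < c ∧ 0 < C ∧ ∀ y : Y, c * ‖y‖ ≤ p y ∧ p y ≤ C * ‖y‖

/-- A real normed space is reflexive if the canonical map into its bidual is onto. -/
def IsReflexiveSpace (Y : Type*) [NormedAddCommGroup Y] [NormedSpace ℝ Y] : Prop :=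
  Function.Surjective (NormedSpace.inclusionInDoubleDual ℝ Y)

/-- The set `Ω`, viewed in `Y` endowed with the weak topology. -/
def inWeak {Y : Type*} [NormedAddCommGroup Y] [NormedSpace ℝ Y] (Ω : Set Y) :
    Set (WeakSpace ℝ Y) :=
  toWeakSpace ℝ Y '' Ω

end ConeSep

/-!
Let `C = conv (-K)`. Separating `0` from `S_{-K}(‖·‖)` gives a continuous functional `f` and `d > 0`
with `d * ‖x‖ ≤ f x` on `C`, and weak compactness gives `ε > 0` with `ε * ‖x‖ ≤ dist(x, C)` on `A`.
The function `g x = f x + d * dist(x, C)` is sublinear, and `p x = max (g x) (g (-x))` is an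
equivalent norm. On `C` it equals `f`, because there `g (-x) ≤ -f x + d * ‖x‖ ≤ 0`; on `A` it
exceeds `f` by at least `d * ε * ‖x‖`. So `f` separates the two norm bases of `p` strictly.
-/

namespace ConeSep

open Set Metric

section Module

variable {E : Type*} [AddCommGroup E] [Module ℝ E] {C : Set E}

theorem IsCone.smul_mem (hC : IsCone C) {t : ℝ} (ht : 0 ≤ t) {x : E} (hx : x ∈ C) :
    t • x ∈ C := by
  rw [hC.2]
  exact smul_mem_smul ht hx

theorem isCone_iff : IsCone C ↔ (0 : E) ∈ C ∧ ∀ t : ℝ, 0 ≤ t → ∀ x ∈ C, t • x ∈ C := by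
  refine ⟨fun hC => ⟨hC.1, fun t ht x hx => hC.smul_mem ht hx⟩, fun ⟨h0, hsmul⟩ => ⟨h0, ?_⟩⟩
  refine Subset.antisymm (fun x hx => ?_) (smul_subset_iff.2 hsmul)
  exact mem_smul.2 ⟨1, mem_Ici.2 zero_le_one, x, hx, one_smul ℝ x⟩

theorem IsCone.nonempty (hC : IsCone C) : C.Nonempty :=
  ⟨0, hC.1⟩

theorem IsCone.neg (hC : IsCone C) : IsCone (-C) :=
  isCone_iff.2 ⟨by simpa using hC.1, fun t ht x hx => by simpa using hC.smul_mem ht hx⟩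

theorem isCone_convexHull (hC : IsCone C) : IsCone (convexHull ℝ C) := by
  refine isCone_iff.2 ⟨subset_convexHull ℝ C hC.1, fun t ht x hx => ?_⟩
  have hsub : t • C ⊆ C := smul_set_subset_iff.2 fun _ hy => hC.smul_mem ht hy
  have hmem : t • x ∈ convexHull ℝ (t • C) := by
    rw [convexHull_smul]
    exact smul_mem_smul_set hx
  exact convexHull_mono hsub hmem

/-- The symmetrization `x ↦ max (g x) (g (-x))` of a sublinear function `g`, as a seminorm. -/
def symmetrization (g : E → ℝ) (hadd : ∀ x y, g (x + y) ≤ g x + g y)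
    (hsmul : ∀ t : ℝ, 0 ≤ t → ∀ x, g (t • x) = t * g x) : Seminorm ℝ E :=
  Seminorm.of (fun x => max (g x) (g (-x)))
    (fun x y => max_le
      ((hadd x y).trans (add_le_add (le_max_left _ _) (le_max_left _ _)))
      (by
        rw [neg_add]
        exact (hadd _ _).trans (add_le_add (le_max_right _ _) (le_max_right _ _))))
    (fun t x => by
      rw [Real.norm_eq_abs, mul_max_of_nonneg _ _ (abs_nonneg t), ← hsmul _ (abs_nonneg t),
        ← hsmul _ (abs_nonneg t)]
      rcases abs_choice t with h | h
      · simp only [h, smul_neg]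
      · simp only [h, neg_smul, smul_neg, neg_neg]
        exact max_comm _ _)

end Module

section InfDist

variable {E : Type*} [SeminormedAddCommGroup E] [NormedSpace ℝ E] {C : Set E}

theorem convexOn_infDist (hC : Convex ℝ C) (hne : C.Nonempty) :
    ConvexOn ℝ univ fun x => infDist x C := by
  refine ⟨convex_univ, fun x _ y _ a b ha hb hab => le_of_forall_pos_le_add fun δ hδ => ?_⟩
  obtain ⟨u, hu, hxu⟩ := (infDist_lt_iff hne).1 (lt_add_of_pos_right (infDist x C) hδ)
  obtain ⟨v, hv, hyv⟩ := (infDist_lt_iff hne).1 (lt_add_of_pos_right (infDist y C) hδ)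
  calc infDist (a • x + b • y) C ≤ dist (a • x + b • y) (a • u + b • v) :=
        infDist_le_dist_of_mem (hC hu hv ha hb hab)
    _ ≤ dist (a • x) (a • u) + dist (b • y) (b • v) := dist_add_add_le _ _ _ _
    _ = a * dist x u + b * dist y v := by
        rw [dist_smul₀, dist_smul₀, Real.norm_of_nonneg ha, Real.norm_of_nonneg hb]
    _ ≤ a * (infDist x C + δ) + b * (infDist y C + δ) := by gcongr
    _ = a • infDist x C + b • infDist y C + δ := by
        simp only [smul_eq_mul]
        linear_combination δ * hab

theorem IsCone.infDist_smul (hC : IsCone C) {t : ℝ} (ht : 0 ≤ t) (x : E) :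
    infDist (t • x) C = t * infDist x C := by
  rcases ht.eq_or_lt with rfl | hpos
  · simpa using infDist_zero_of_mem hC.1
  have hCt : t • C = C := by
    refine Subset.antisymm (smul_set_subset_iff.2 fun _ hy => hC.smul_mem ht hy) fun y hy => ?_
    exact (mem_smul_set_iff_inv_smul_mem₀ hpos.ne' C y).2 (hC.smul_mem (inv_nonneg.2 ht) hy)
  rw [← Real.norm_of_nonneg ht, ← infDist_smul₀ hpos.ne', Real.norm_of_nonneg ht, hCt]

theorem IsCone.infDist_add_le (hC : IsCone C) (hconv : Convex ℝ C) (x y : E) :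
    infDist (x + y) C ≤ infDist x C + infDist y C := by
  have hmid : infDist ((2⁻¹ : ℝ) • x + (2⁻¹ : ℝ) • y) C ≤
      (2⁻¹ : ℝ) • infDist x C + (2⁻¹ : ℝ) • infDist y C :=
    (convexOn_infDist hconv hC.nonempty).2 (mem_univ x) (mem_univ y)
      (by norm_num) (by norm_num) (by norm_num)
  rw [← smul_add, hC.infDist_smul (by norm_num), smul_eq_mul, smul_eq_mul] at hmid
  linarith

theorem IsCone.infDist_le_norm (hC : IsCone C) (x : E) : infDist x C ≤ ‖x‖ := by
  simpa using infDist_le_dist_of_mem (x := x) hC.1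

theorem mul_norm_sub_le_mul_infDist (hne : C.Nonempty) {f : StrongDual ℝ E} {d : ℝ} (hd : 0 < d)
    (hf : ∀ x ∈ C, d * ‖x‖ ≤ f x) (x : E) : d * ‖x‖ - f x ≤ (‖f‖ + d) * infDist x C := by
  rw [← div_le_iff₀' (by positivity)]
  refine (le_infDist hne).2 fun c hc => ?_
  rw [div_le_iff₀' (by positivity), dist_eq_norm]
  have hnorm : d * ‖x‖ ≤ d * (‖c‖ + ‖x - c‖) := by
    gcongr
    exact norm_le_norm_add_norm_sub' x c
  have hfc : f c - f x ≤ ‖f‖ * ‖x - c‖ := by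
    rw [← map_sub, norm_sub_rev]
    exact (le_abs_self _).trans (f.le_opNorm _)
  linarith [hf c hc]

/-- The seminorm obtained by symmetrizing the sublinear function `x ↦ f x + d * dist(x, C)`. If `f`
dominates `d * ‖·‖` on `C` and `0 < d`, it is an equivalent norm that agrees with `f` on `C` and
exceeds `f` away from `C`. -/
noncomputable def separatingSeminorm (hC : IsCone C) (hconv : Convex ℝ C) (f : StrongDual ℝ E)
    {d : ℝ} (hd : 0 ≤ d) : Seminorm ℝ E :=
  symmetrization (fun x => f x + d * infDist x C)
    (fun x y => by
      rw [map_add]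
      linarith [mul_le_mul_of_nonneg_left (hC.infDist_add_le hconv x y) hd])
    (fun t ht x => by
      rw [map_smul, smul_eq_mul, hC.infDist_smul ht]
      ring)

variable {f : StrongDual ℝ E} {d : ℝ}

theorem separatingSeminorm_apply (hC : IsCone C) (hconv : Convex ℝ C) (hd : 0 ≤ d) (x : E) :
    separatingSeminorm hC hconv f hd x =
      max (f x + d * infDist x C) (-f x + d * infDist (-x) C) := by
  rw [← map_neg]
  rfl

theorem add_mul_infDist_le_separatingSeminorm (hC : IsCone C) (hconv : Convex ℝ C) (hd : 0 ≤ d)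
    (x : E) : f x + d * infDist x C ≤ separatingSeminorm hC hconv f hd x := by
  rw [separatingSeminorm_apply]
  exact le_max_left _ _

theorem separatingSeminorm_le_of_mem (hC : IsCone C) (hconv : Convex ℝ C) (hd : 0 ≤ d)
    (hf : ∀ x ∈ C, d * ‖x‖ ≤ f x) {x : E} (hx : x ∈ C) :
    separatingSeminorm hC hconv f hd x ≤ f x := by
  rw [separatingSeminorm_apply, infDist_zero_of_mem hx]
  have hneg : d * infDist (-x) C ≤ d * ‖x‖ := by
    gcongr
    simpa using hC.infDist_le_norm (-x)
  refine max_le (by simp) ?_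
  linarith [hf x hx, mul_nonneg hd (norm_nonneg x)]

theorem separatingSeminorm_le_mul_norm (hC : IsCone C) (hconv : Convex ℝ C) (hd : 0 ≤ d) (x : E) :
    separatingSeminorm hC hconv f hd x ≤ (‖f‖ + d) * ‖x‖ := by
  have hfx : |f x| ≤ ‖f‖ * ‖x‖ := f.le_opNorm x
  have hpos : d * infDist x C ≤ d * ‖x‖ := by
    gcongr
    exact hC.infDist_le_norm x
  have hneg : d * infDist (-x) C ≤ d * ‖x‖ := by
    gcongr
    simpa using hC.infDist_le_norm (-x)
  rw [separatingSeminorm_apply]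
  refine max_le ?_ ?_ <;> linarith [le_abs_self (f x), neg_le_abs (f x)]

theorem mul_norm_le_separatingSeminorm (hC : IsCone C) (hconv : Convex ℝ C) (hd : 0 < d)
    (hf : ∀ x ∈ C, d * ‖x‖ ≤ f x) (x : E) :
    d ^ 2 / (‖f‖ + d) * ‖x‖ ≤ separatingSeminorm hC hconv f hd.le x := by
  have hM : 0 < ‖f‖ + d := by positivity
  have hdist : 2 * d * ‖x‖ ≤ (‖f‖ + d) * (infDist x C + infDist (-x) C) := by
    have hpos := mul_norm_sub_le_mul_infDist hC.nonempty hd hf x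
    have hneg := mul_norm_sub_le_mul_infDist hC.nonempty hd hf (-x)
    rw [norm_neg, map_neg] at hneg
    linarith
  have havg : d * (infDist x C + infDist (-x) C) ≤ 2 * separatingSeminorm hC hconv f hd.le x := by
    rw [separatingSeminorm_apply]
    linarith [le_max_left (f x + d * infDist x C) (-f x + d * infDist (-x) C),
      le_max_right (f x + d * infDist x C) (-f x + d * infDist (-x) C)]
  rw [div_mul_eq_mul_div, div_le_iff₀ hM]
  linarith [mul_le_mul_of_nonneg_left hdist hd.le, mul_le_mul_of_nonneg_left havg hM.le]

end InfDist

theorem lowerSemicontinuous_comp_toWeakSpace_symm {E : Type*} [AddCommGroup E] [Module ℝ E]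
    [TopologicalSpace E] [IsTopologicalAddGroup E] [ContinuousSMul ℝ E] [LocallyConvexSpace ℝ E]
    {g : E → ℝ} (hconv : ConvexOn ℝ univ g) (hg : LowerSemicontinuous g) :
    LowerSemicontinuous (g ∘ (toWeakSpace ℝ E).symm) := by
  refine lowerSemicontinuous_iff_isClosed_preimage.2 fun r => ?_
  have hset : Convex ℝ (g ⁻¹' Iic r) := by
    simpa only [mem_univ, true_and, preimage, mem_Iic] using hconv.convex_le r
  have himage := hset.toWeakSpace_closure ℝ
  rw [(hg.isClosed_preimage r).closure_eq] at himage
  rw [preimage_comp, ← LinearEquiv.image_eq_preimage_symm, himage]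
  exact isClosed_closure

variable {Y : Type*} [NormedAddCommGroup Y] [NormedSpace ℝ Y] {A B C : Set Y}

theorem IsReflexiveSpace.isCompact_closure_inWeak (hY : IsReflexiveSpace Y)
    (hB : Bornology.IsBounded B) : IsCompact (closure (inWeak B)) := by
  refine NormedSpace.isCompact_closure_of_isBounded ℝ Y _ ?_ fun z _ => ?_
  · rwa [inWeak, preimage_image_eq _ (toWeakSpace ℝ Y).injective]
  · obtain ⟨y, hy⟩ := hY (WeakDual.toStrongDual z)
    exact ⟨toWeakSpace ℝ Y y, hy⟩

theorem isBounded_normBase_normSeminorm (C : Set Y) :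
    Bornology.IsBounded (normBase (normSeminorm ℝ Y) C) :=
  (isBounded_sphere (x := (0 : Y)) (r := 1)).subset fun _ hx => mem_sphere_zero_iff_norm.2 hx.2

theorem IsCone.inv_norm_smul_mem_normBase (hC : IsCone C) {x : Y} (hx : x ∈ C) (hx0 : x ≠ 0) :
    ‖x‖⁻¹ • x ∈ normBase (normSeminorm ℝ Y) C :=
  ⟨hC.smul_mem (inv_nonneg.2 (norm_nonneg x)) hx, norm_smul_inv_norm (𝕜 := ℝ) hx0⟩

theorem IsCone.exists_mul_norm_le_of_zero_notMem_closure_S (hC : IsCone C)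
    (h0 : (0 : Y) ∉ closure (S (normSeminorm ℝ Y) C)) :
    ∃ (f : StrongDual ℝ Y) (d : ℝ), 0 < d ∧ ∀ x ∈ convexHull ℝ C, d * ‖x‖ ≤ f x := by
  obtain ⟨f, d, hd, hf⟩ :=
    geometric_hahn_banach_point_closed (convex_convexHull ℝ _).closure isClosed_closure h0
  rw [map_zero] at hd
  have hfC : ∀ x ∈ C, d * ‖x‖ ≤ f x := fun x hx => by
    rcases eq_or_ne x 0 with rfl | hx0
    · simp
    have hbase := hf _ (subset_closure
      (subset_convexHull ℝ _ (hC.inv_norm_smul_mem_normBase hx hx0)))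
    rw [map_smul, smul_eq_mul, ← div_eq_inv_mul, lt_div_iff₀ (norm_pos_iff.2 hx0)] at hbase
    exact hbase.le
  have hconv : ConvexOn ℝ univ fun x => d * ‖x‖ - f x :=
    (convexOn_univ_norm.smul hd.le).sub (f.toLinearMap.concaveOn convex_univ)
  have hsub : convexHull ℝ C ⊆ {x ∈ univ | d * ‖x‖ - f x ≤ 0} :=
    convexHull_min (fun x hx => ⟨mem_univ x, sub_nonpos.2 (hfC x hx)⟩) (hconv.convex_le 0)
  exact ⟨f, d, hd, fun x hx => sub_nonpos.1 (hsub hx).2⟩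

theorem exists_pos_le_infDist (hC : Convex ℝ C) (hne : C.Nonempty) {f : StrongDual ℝ Y} {d : ℝ}
    (hd : 0 < d) (hf : ∀ x ∈ C, d * ‖x‖ ≤ f x) (hB : ∀ x ∈ B, 1 ≤ ‖x‖)
    (hcomp : IsCompact (closure (inWeak B)))
    (hBC : closure (inWeak B) ∩ inWeak (closure C) ⊆ {0}) :
    ∃ ε > 0, ∀ x ∈ B, ε ≤ infDist x C := by
  have hM : 0 < ‖f‖ + d := by positivity
  rcases B.eq_empty_or_nonempty with rfl | hBne
  · exact ⟨1, one_pos, by simp⟩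
  -- The distance to `C` vanishes at `0`, which may lie in the weak closure of `B`; the second term
  -- is positive there, and on `B` itself it is dominated by the first.
  let g : Y → ℝ := fun x => max ((‖f‖ + d) * infDist x C) (d - f x)
  have hgconv : ConvexOn ℝ univ g := ((convexOn_infDist hC hne).smul hM.le).sup
    ((convexOn_const d convex_univ).sub (f.toLinearMap.concaveOn convex_univ))
  have hgcont : Continuous g := by fun_prop
  have hgpos : ∀ x, toWeakSpace ℝ Y x ∈ closure (inWeak B) → 0 < g x := fun x hxB => by
    by_contra! hle
    obtain ⟨hdist, hfx⟩ := max_le_iff.1 hle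
    have hxC : x ∈ closure C := (mem_closure_iff_infDist_zero hne).2
      ((nonpos_of_mul_nonpos_right hdist hM).antisymm infDist_nonneg)
    obtain rfl : x = 0 :=
      (toWeakSpace ℝ Y).map_eq_zero_iff.1 (hBC ⟨hxB, mem_image_of_mem _ hxC⟩)
    rw [map_zero] at hfx
    linarith
  have hglsc : LowerSemicontinuous (g ∘ (toWeakSpace ℝ Y).symm) :=
    lowerSemicontinuous_comp_toWeakSpace_symm hgconv hgcont.lowerSemicontinuous
  obtain ⟨w, hwB, hwmin⟩ := LowerSemicontinuousOn.exists_isMinOn (hBne.image _).closure hcomp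
    (hglsc.lowerSemicontinuousOn _)
  obtain ⟨y, rfl⟩ := (toWeakSpace ℝ Y).surjective w
  refine ⟨g y / (‖f‖ + d), div_pos (hgpos y hwB) hM, fun x hx => ?_⟩
  rw [div_le_iff₀' hM]
  have hgx : g x ≤ (‖f‖ + d) * infDist x C := by
    refine max_le le_rfl (le_trans ?_ (mul_norm_sub_le_mul_infDist hne hd hf x))
    gcongr
    exact le_mul_of_one_le_right hd.le (hB x hx)
  exact (hwmin (subset_closure (mem_image_of_mem _ hx))).trans hgx

theorem IsCone.exists_pos_mul_norm_le_infDist (hA : IsCone A) (hC : IsCone C)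
    (hconv : Convex ℝ C) {f : StrongDual ℝ Y} {d : ℝ} (hd : 0 < d)
    (hf : ∀ x ∈ C, d * ‖x‖ ≤ f x)
    (hcomp : IsCompact (closure (inWeak (normBase (normSeminorm ℝ Y) A))))
    (hAC : closure (inWeak (normBase (normSeminorm ℝ Y) A)) ∩ inWeak (closure C) ⊆ {0}) :
    ∃ ε > 0, ∀ x ∈ A, ε * ‖x‖ ≤ infDist x C := by
  obtain ⟨ε, hε, hbase⟩ :=
    exists_pos_le_infDist hconv hC.nonempty hd hf (fun x hx => hx.2.ge) hcomp hAC
  refine ⟨ε, hε, fun x hx => ?_⟩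
  rcases eq_or_ne x 0 with rfl | hx0
  · simpa using infDist_nonneg
  have hunit := hbase _ (hA.inv_norm_smul_mem_normBase hx hx0)
  rwa [hC.infDist_smul (inv_nonneg.2 (norm_nonneg x)), ← div_eq_inv_mul,
    le_div_iff₀ (norm_pos_iff.2 hx0)] at hunit

theorem isEquivalentNorm_separatingSeminorm (hC : IsCone C) (hconv : Convex ℝ C)
    {f : StrongDual ℝ Y} {d : ℝ} (hd : 0 < d) (hf : ∀ x ∈ C, d * ‖x‖ ≤ f x) :
    IsEquivalentNorm (separatingSeminorm hC hconv f hd.le) :=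
  ⟨d ^ 2 / (‖f‖ + d), ‖f‖ + d, by positivity, by positivity, fun x =>
    ⟨mul_norm_le_separatingSeminorm hC hconv hd hf x,
      separatingSeminorm_le_mul_norm hC hconv hd.le x⟩⟩

theorem closure_S0_subset {p : Seminorm ℝ Y} {f : StrongDual ℝ Y} {r : ℝ} (hr : 0 ≤ r)
    (hA : ∀ x ∈ normBase p A, f x ≤ r) : closure (S0 p A) ⊆ {x | f x ≤ r} := by
  refine closure_minimal (convexHull_min ?_ (convex_halfSpace_le f.toLinearMap.isLinear _))
    (isClosed_le f.continuous continuous_const)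
  rintro x (rfl | hx)
  · simpa using hr
  · exact hA x hx

theorem closure_S_subset {p : Seminorm ℝ Y} {f : StrongDual ℝ Y} {r : ℝ}
    (hC : ∀ x ∈ normBase p C, r ≤ f x) : closure (S p C) ⊆ {x | r ≤ f x} :=
  closure_minimal (convexHull_min hC (convex_halfSpace_ge f.toLinearMap.isLinear _))
    (isClosed_le continuous_const f.continuous)

theorem closure_S0_inter_closure_S_eq_empty {p : Seminorm ℝ Y} (hp : IsEquivalentNorm p)
    {f : StrongDual ℝ Y} {δ : ℝ} (hδ : 0 < δ) (hA : ∀ x ∈ A, f x + δ * ‖x‖ ≤ p x)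
    (hC : ∀ x ∈ C, p x ≤ f x) : closure (S0 p A) ∩ closure (S p C) = ∅ := by
  obtain ⟨_, M, _, hM, hpM⟩ := hp
  have hbaseA : ∀ x ∈ normBase p A, f x ≤ max 0 (1 - δ / M) := fun x ⟨hxA, hpx⟩ => by
    have hnorm : 1 / M ≤ ‖x‖ := (div_le_iff₀' hM).2 (hpx ▸ (hpM x).2)
    have hgap : δ / M ≤ δ * ‖x‖ := by
      rw [div_eq_mul_one_div]
      gcongr
    exact le_max_of_le_right (by linarith [hA x hxA])
  have hbaseC : ∀ x ∈ normBase p C, 1 ≤ f x := fun x ⟨hxC, hpx⟩ => hpx ▸ hC x hxC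
  refine eq_empty_of_forall_notMem fun x ⟨hxA, hxC⟩ => ?_
  have hlt : max 0 (1 - δ / M) < 1 := max_lt one_pos (sub_lt_self 1 (by positivity))
  exact (hlt.trans_le (closure_S_subset hbaseC hxC)).not_ge
    (closure_S0_subset (le_max_left _ _) hbaseA hxA)

theorem isCompact_closure_inWeak_normBase
    (hA : IsCompact (normBase (normSeminorm ℝ Y) A) ∨
      (IsClosed (inWeak A) ∧
        (IsReflexiveSpace Y ∨ IsCompact (closure (inWeak (normBase (normSeminorm ℝ Y) A)))))) :
    IsCompact (closure (inWeak (normBase (normSeminorm ℝ Y) A))) ∧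
      closure (inWeak (normBase (normSeminorm ℝ Y) A)) ⊆ inWeak A := by
  have hBA : inWeak (normBase (normSeminorm ℝ Y) A) ⊆ inWeak A := image_mono fun x hx => hx.1
  rcases hA with hcomp | ⟨hclosed, hY | hcomp⟩
  · have hweak : IsCompact (inWeak (normBase (normSeminorm ℝ Y) A)) :=
      hcomp.image (toWeakSpaceCLM ℝ Y).continuous
    rw [hweak.isClosed.closure_eq]
    exact ⟨hweak, hBA⟩
  · exact ⟨hY.isCompact_closure_inWeak (isBounded_normBase_normSeminorm A),
      closure_minimal hBA hclosed⟩
  · exact ⟨hcomp, closure_minimal hBA hclosed⟩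

theorem inter_inWeak_subset_zero {W : Set (WeakSpace ℝ Y)} (hW : W ⊆ inWeak A) (hAC : A ∩ C ⊆ {0}) :
    W ∩ inWeak C ⊆ {0} :=
  calc W ∩ inWeak C ⊆ inWeak A ∩ inWeak C := inter_subset_inter_left _ hW
    _ = inWeak (A ∩ C) := (image_inter (toWeakSpace ℝ Y).injective).symm
    _ ⊆ inWeak {0} := image_mono hAC
    _ = {0} := by rw [inWeak, image_singleton, map_zero]

end ConeSep

open ConeSep Metric in
theorem mainTheorem10_general {Y : Type*} [NormedAddCommGroup Y] [NormedSpace ℝ Y]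
    {K A : Set Y} (hK : IsCone K) (hA : IsCone A)
    (h0 : (0 : Y) ∉ closure (S (normSeminorm ℝ Y) (-K)))
    (hcomp : IsCompact (closure (inWeak (normBase (normSeminorm ℝ Y) A))))
    (hAK : closure (inWeak (normBase (normSeminorm ℝ Y) A)) ∩
      inWeak (closure (convexHull ℝ (-K))) ⊆ {0}) :
    ∃ p : Seminorm ℝ Y, IsEquivalentNorm p ∧ closure (S0 p A) ∩ closure (S p (-K)) = ∅ := by
  have hC : IsCone (convexHull ℝ (-K)) := isCone_convexHull hK.neg
  have hconv : Convex ℝ (convexHull ℝ (-K)) := convex_convexHull ℝ (-K)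
  obtain ⟨f, d, hd, hf⟩ := hK.neg.exists_mul_norm_le_of_zero_notMem_closure_S h0
  obtain ⟨ε, hε, hangle⟩ := hA.exists_pos_mul_norm_le_infDist hC hconv hd hf hcomp hAK
  have hp := isEquivalentNorm_separatingSeminorm hC hconv hd hf
  refine ⟨separatingSeminorm hC hconv f hd.le, hp,
    closure_S0_inter_closure_S_eq_empty hp (mul_pos hd hε) (fun x hx => ?_) fun x hx =>
      separatingSeminorm_le_of_mem hC hconv hd.le hf (subset_convexHull ℝ _ hx)⟩
  calc f x + d * ε * ‖x‖ ≤ f x + d * infDist x (convexHull ℝ (-K)) := by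
        rw [mul_assoc]
        gcongr
        exact hangle x hx
    _ ≤ _ := add_mul_infDist_le_separatingSeminorm hC hconv hd.le x

theorem mainTheorem10 {Y : Type*} [NormedAddCommGroup Y] [NormedSpace ℝ Y]
    (hdim : 2 ≤ Module.rank ℝ Y)
    (K A : Set Y) (hK : ConeSep.IsNontrivialCone K) (hA : ConeSep.IsNontrivialCone A)
    (hAK : A ∩ closure (convexHull ℝ (-K)) = {0})
    (h0 : (0 : Y) ∉ closure (ConeSep.S (normSeminorm ℝ Y) (-K)))
    (hab : IsCompact (ConeSep.normBase (normSeminorm ℝ Y) A) ∨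
      (IsClosed (ConeSep.inWeak A) ∧
        (ConeSep.IsReflexiveSpace Y ∨
          (IsCompact (closure (ConeSep.inWeak (ConeSep.normBase (normSeminorm ℝ Y) A))) ∧
            (0 : WeakSpace ℝ Y) ∉
              closure (ConeSep.inWeak (ConeSep.normBase (normSeminorm ℝ Y) A)))))) :
    ∃ p : Seminorm ℝ Y, ConeSep.IsEquivalentNorm p ∧
      closure (ConeSep.S0 p A) ∩ closure (ConeSep.S p (-K)) = ∅ := by
  obtain ⟨hcomp, hsub⟩ := ConeSep.isCompact_closure_inWeak_normBase
    (hab.imp_right (And.imp_right (Or.imp_right And.left)))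
  exact mainTheorem10_general hK.1 hA.1 h0 hcomp (ConeSep.inter_inWeak_subset_zero hsub hAK.subset)
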